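/- For $p\ge 1$ and $n\ge 0$ put $t_n(p;z):=\sum_{k=1}^n \frac{z^k}{(k-1/2)^p}$. For a root of unity $z$ and $p\geq 1$ with $(p,z)\ne(1,1)$ put $$\mathrm{Li}_p(z):=\sum_{n=1}^\infty\frac{z^n}{n^p},\qquad \mathrm{ti}_p(z):=\sum_{n=1}^\infty\frac{z^n}{(n-1/2)^p},$$ and, for roots of unity $y,z$ and $p,q\ge1$ with $(p,y),(q,z)\neq(1,1)$, let the linear cyclotomic Euler $\tilde S$-sum be $$\tilde S_{p;q}(y;z):=\sum_{n=1}^\infty \frac{t_n(p;y)}{n^q}z^n .$$ All these series are understood as limits of their partial sums, and these limits exist. **Theorem.** Let $x,y$ be roots of unity and let $p,q\ge 1$ be integers with $(p,y)\ne(1,1)$ and $(q,xy)\neq(1,1)$. Then $$\begin{aligned} &y^{-1}\tilde S_{p;q}\big(y;(xy)^{-1}\big)-(-1)^{p+q}\tilde S_{p;q}\big(y^{-1};xy\big)\\ &=y^{-1}\mathrm{Li}_q\big((xy)^{-1}\big)\mathrm{ti}_p(y)+(-1)^q y^{-1}\mathrm{Li}_q(xy)\,\mathrm{ti}_p(y)+(-1)^q\binom{p+q-1}{p-1}y^{-1}\mathrm{ti}_{p+q}(y)\\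 &\quad+(-1)^q(xy)^{-1}\sum_{m=0}^{p-1}\binom{p+q-m-2}{q-1}\mathrm{ti}_{p+q-m-1}(xy)\Big((-1)^m\mathrm{ti}_{m+1}(x)-x\,\mathrm{ti}_{m+1}(x^{-1})\Big)\\ &\quad+(-1)^q y^{-1}\sum_{m=0}^{q-1}\binom{p+q-m-2}{p-1}\mathrm{ti}_{p+q-m-1}(y)\Big((-1)^m\mathrm{Li}_{m+1}(x^{-1})-\mathrm{Li}_{m+1}(x)\Big). \end{aligned}$$ If $x=1$, the two brackets with $m=0$, which are formally $\mathrm{ti}_1(1)-\mathrm{ti}_1(1)$ and $\mathrm{Li}_1(1)-\mathrm{Li}_1(1)$, are read as $0$. -/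

import Mathlib

open Filter Topology

noncomputable section

namespace CyclotomicEuler

/-- `a` is a root of unity in `ℂ`. -/
def IsRootOfUnity (a : ℂ) : Prop := ∃ N : ℕ, 1 ≤ N ∧ a ^ N = 1

/-- The finite polylogarithm sum `ζ_n(p; x) = ∑_{k=1}^n x^k / k^p`. -/
def zetaSum (n p : ℕ) (x : ℂ) : ℂ :=
  ∑ k ∈ Finset.Icc 1 n, x ^ k / (k : ℂ) ^ p

/-- The finite `t`-polylogarithm sum `t_n(p; x) = ∑_{k=1}^n x^k / (k - 1/2)^p`. -/
def tSum (n p : ℕ) (x : ℂ) : ℂ :=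
  ∑ k ∈ Finset.Icc 1 n, x ^ k / ((k : ℂ) - 1 / 2) ^ p

/-- The partial sum `∑_{n=1}^M t_n(p; y) / n^q * x^n` of the linear Euler `S̃`-sum. -/
def stPartial (M p q : ℕ) (y x : ℂ) : ℂ :=
  ∑ n ∈ Finset.Icc 1 M, tSum n p y / (n : ℂ) ^ q * x ^ n

/-- A sequence of complex numbers has a (finite) limit. -/
def Converges (u : ℕ → ℂ) : Prop := ∃ l : ℂ, Tendsto u atTop (𝓝 l)

/-- The polylogarithm `Li_p(x) = lim_n ζ_n(p; x)` (the series may converge only conditionally). -/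
def Li (p : ℕ) (x : ℂ) : ℂ := limUnder atTop (fun n : ℕ => zetaSum n p x)

/-- The `t`-polylogarithm `ti_p(x) = lim_n t_n(p; x)`. -/
def ti (p : ℕ) (x : ℂ) : ℂ := limUnder atTop (fun n : ℕ => tSum n p x)

/-- The linear cyclotomic Euler `S̃`-sum `S̃_{p;q}(y; x) = ∑_{n ≥ 1} t_n(p; y) x^n / n^q`,
as the limit of its partial sums. -/
def St (p q : ℕ) (y x : ℂ) : ℂ := limUnder atTop (fun M : ℕ => stPartial M p q y x)

end CyclotomicEuler

end

namespace CyclotomicEuler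

lemma sum_Icc_one_eq_sum_range (f : ℕ → ℂ) (n : ℕ) :
    ∑ k ∈ Finset.Icc 1 n, f k = ∑ j ∈ Finset.range n, f (j + 1) := by
  induction n with
  | zero => simp
  | succ n ih => rw [Finset.sum_Icc_succ_top (by omega), ih, Finset.sum_range_succ]

lemma tSum_eq_range (n p : ℕ) (x : ℂ) :
    tSum n p x = ∑ j ∈ Finset.range n, x ^ (j + 1) / ((j : ℂ) + 1 / 2) ^ p := by
  rw [tSum, sum_Icc_one_eq_sum_range]
  refine Finset.sum_congr rfl fun j _ => ?_
  push_cast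
  ring_nf

lemma zetaSum_eq_range (n p : ℕ) (x : ℂ) :
    zetaSum n p x = ∑ j ∈ Finset.range n, x ^ (j + 1) / ((j : ℂ) + 1) ^ p := by
  rw [zetaSum, sum_Icc_one_eq_sum_range]
  refine Finset.sum_congr rfl fun j _ => ?_
  push_cast
  rfl

lemma stPartial_eq_range (n p q : ℕ) (y x : ℂ) :
    stPartial n p q y x =
      ∑ j ∈ Finset.range n, x ^ (j + 1) / ((j : ℂ) + 1) ^ q * tSum (j + 1) p y := by
  rw [stPartial, sum_Icc_one_eq_sum_range]
  refine Finset.sum_congr rfl fun j _ => ?_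
  push_cast
  ring

lemma IsRootOfUnity.norm_eq_one {x : ℂ} (hx : IsRootOfUnity x) : ‖x‖ = 1 := by
  obtain ⟨N, hN, h⟩ := hx
  exact Complex.norm_eq_one_of_pow_eq_one h (by omega)

lemma Converges.tendsto_limUnder {u : ℕ → ℂ} (h : Converges u) :
    Tendsto u atTop (𝓝 (limUnder atTop u)) := tendsto_nhds_limUnder h

lemma norm_sum_pow_succ_le {w : ℂ} (hw : ‖w‖ = 1) (hw1 : w ≠ 1) (n : ℕ) :
    ‖∑ l ∈ Finset.range n, w ^ (l + 1)‖ ≤ 2 / ‖w - 1‖ := by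
  have h : ∑ l ∈ Finset.range n, w ^ (l + 1) = w * ((w ^ n - 1) / (w - 1)) := by
    rw [← geom_sum_eq hw1, Finset.mul_sum]
    exact Finset.sum_congr rfl fun l _ => by ring
  rw [h, norm_mul, norm_div, hw, one_mul]
  gcongr
  calc ‖w ^ n - 1‖ ≤ ‖w ^ n‖ + ‖(1 : ℂ)‖ := norm_sub_le _ _
    _ = 2 := by rw [norm_pow, hw]; norm_num

/-- Summation by parts. -/
lemma tendsto_sum_pow_mul {w : ℂ} (hw : ‖w‖ = 1) (hw1 : w ≠ 1) {g : ℕ → ℂ}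
    (hg : Tendsto g atTop (𝓝 0)) (hs : Summable fun j => ‖g j - g (j + 1)‖) :
    Tendsto (fun J => ∑ j ∈ Finset.range J, w ^ (j + 1) * g j) atTop
      (𝓝 (∑' j, (∑ l ∈ Finset.range (j + 1), w ^ (l + 1)) * (g j - g (j + 1)))) := by
  have hsum : Summable fun j =>
      (∑ l ∈ Finset.range (j + 1), w ^ (l + 1)) * (g j - g (j + 1)) := by
    refine Summable.of_norm_bounded (hs.mul_left (2 / ‖w - 1‖)) fun j => ?_
    rw [norm_mul]
    gcongr
    exact norm_sum_pow_succ_le hw hw1 _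
  have hparts : ∀ J, ∑ j ∈ Finset.range J, w ^ (j + 1) * g j =
      (∑ l ∈ Finset.range J, w ^ (l + 1)) * g J + ∑ j ∈ Finset.range J,
        (∑ l ∈ Finset.range (j + 1), w ^ (l + 1)) * (g j - g (j + 1)) := by
    intro J
    induction J with
    | zero => simp
    | succ J ih =>
      rw [Finset.sum_range_succ, ih, Finset.sum_range_succ (fun j =>
        (∑ l ∈ Finset.range (j + 1), w ^ (l + 1)) * (g j - g (j + 1))) J,
        Finset.sum_range_succ (fun l => w ^ (l + 1)) J]
      ring
  have hbd : Tendsto (fun J => (∑ l ∈ Finset.range J, w ^ (l + 1)) * g J) atTop (𝓝 0) := by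
    refine squeeze_zero_norm (a := fun J => 2 / ‖w - 1‖ * ‖g J‖) (fun J => ?_) ?_
    · rw [norm_mul]
      gcongr
      exact norm_sum_pow_succ_le hw hw1 _
    · simpa using hg.norm.const_mul (2 / ‖w - 1‖)
  simp_rw [hparts]
  simpa using hbd.add hsum.hasSum.tendsto_sum_nat

lemma rpow_three_halves {t : ℝ} (ht : 0 ≤ t) : t ^ (3 / 2 : ℝ) = t * √t := by
  rw [show (3 / 2 : ℝ) = 1 + 1 / 2 by norm_num, Real.rpow_add_of_nonneg ht (by norm_num)
    (by norm_num), Real.rpow_one, Real.sqrt_eq_rpow]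

lemma summable_one_div_succ_mul_sqrt :
    Summable fun j : ℕ => 1 / (((j : ℝ) + 1) * √((j : ℝ) + 1)) := by
  refine ((Real.summable_one_div_nat_add_rpow 1 (3 / 2)).2 (by norm_num)).congr fun j => ?_
  rw [abs_of_pos (by positivity), rpow_three_halves (by positivity)]

lemma summable_one_div_int_mul_sqrt :
    Summable fun k : ℤ => 1 / (|(k : ℝ) + 1 / 2| * √|(k : ℝ) + 1 / 2|) := by
  refine ((Real.summable_one_div_int_add_rpow (1 / 2) (3 / 2)).2 (by norm_num)).congr fun j => ?_
  rw [rpow_three_halves (abs_nonneg _)]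

lemma summable_one_div_int_sq :
    Summable fun k : ℤ => (1 / |(k : ℝ) + 1 / 2|) ^ 2 := by
  refine ((Real.summable_one_div_int_add_rpow (1 / 2) 2).2 (by norm_num)).congr fun j => ?_
  rw [div_pow, one_pow]
  norm_cast

lemma summable_sqrt_mul_weight {a : ℝ} (ha : 1 / 2 ≤ a) :
    Summable fun j : ℕ => √((j : ℝ) + 1) * (1 / (((j : ℝ) + a) * ((j : ℝ) + a))) := by
  refine Summable.of_nonneg_of_le (fun j => by positivity) (fun j => ?_)
    (summable_one_div_succ_mul_sqrt.mul_left 4)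
  have hs := Real.mul_self_sqrt (show (0 : ℝ) ≤ (j : ℝ) + 1 by positivity)
  have h0 : 0 < √((j : ℝ) + 1) := by positivity
  rw [mul_one_div, mul_one_div, div_le_div_iff₀ (by positivity) (by positivity)]
  set s := √((j : ℝ) + 1)
  have hj : (0 : ℝ) ≤ j := by positivity
  have : s * (((j : ℝ) + 1) * s) = ((j : ℝ) + 1) * ((j : ℝ) + 1) := by rw [← hs]; ring
  rw [this]
  nlinarith [mul_nonneg hj (by linarith : (0:ℝ) ≤ a - 1 / 2)]

lemma norm_natCast_add_ofReal {a : ℝ} (ha : 1 / 2 ≤ a) (j : ℕ) :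
    ‖(j : ℂ) + (a : ℂ)‖ = (j : ℝ) + a := by
  rw [show (j : ℂ) + (a : ℂ) = (((j : ℝ) + a : ℝ) : ℂ) by push_cast; rfl, Complex.norm_real,
    Real.norm_of_nonneg (by positivity)]

lemma natCast_add_ofReal_ne_zero {a : ℝ} (ha : 1 / 2 ≤ a) (j : ℕ) : (j : ℂ) + (a : ℂ) ≠ 0 := by
  rw [← norm_pos_iff, norm_natCast_add_ofReal ha]
  positivity

lemma norm_weight_le {a : ℝ} (ha : 1 / 2 ≤ a) {z : ℂ} (hz : ‖z‖ = 1) {r : ℕ} (hr : 2 ≤ r)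
    (j : ℕ) : ‖z ^ (j + 1) / ((j : ℂ) + a) ^ r‖ ≤
      2 ^ r * (1 / (((j : ℝ) + a) * ((j : ℝ) + a))) := by
  obtain ⟨s, rfl⟩ := Nat.exists_eq_add_of_le hr
  rw [norm_div, norm_pow, norm_pow, hz, one_pow, norm_natCast_add_ofReal ha]
  have h : (0 : ℝ) < j + a := by positivity
  rw [pow_add, pow_add, mul_one_div, div_le_div_iff₀ (by positivity) (by positivity)]
  have h1 : (1 : ℝ) ≤ (2 * ((j : ℝ) + a)) ^ s := one_le_pow₀ (by
    have : (0 : ℝ) ≤ j := by positivity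
    linarith)
  rw [mul_pow] at h1
  nlinarith [mul_le_mul_of_nonneg_left h1 (by positivity : 0 ≤ ((j : ℝ) + a) * ((j : ℝ) + a)),
    (by positivity : 0 ≤ ((j : ℝ) + a) * ((j : ℝ) + a) * (2 ^ s * ((j : ℝ) + a) ^ s))]

lemma weight_sub_eq {a : ℝ} (ha : 1 / 2 ≤ a) (u : ℕ → ℂ) (j : ℕ) :
    u j / ((j : ℂ) + a) - u (j + 1) / (((j + 1 : ℕ) : ℂ) + a) =
      u j * (1 / (((j : ℂ) + a) * (((j + 1 : ℕ) : ℂ) + a)))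
        + (u j - u (j + 1)) / (((j + 1 : ℕ) : ℂ) + a) := by
  have h0 := natCast_add_ofReal_ne_zero ha j
  have h1 := natCast_add_ofReal_ne_zero ha (j + 1)
  push_cast at h1 ⊢
  field_simp
  ring

lemma norm_weight_main_le {a K : ℝ} (ha : 1 / 2 ≤ a) {u : ℕ → ℂ}
    (hK : ∀ j, ‖u j‖ ≤ K * √((j : ℝ) + 1)) (j : ℕ) :
    ‖u j * (1 / (((j : ℂ) + a) * (((j + 1 : ℕ) : ℂ) + a)))‖ ≤
      K * (√((j : ℝ) + 1) * (1 / (((j : ℝ) + a) * ((j : ℝ) + a)))) := by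
  rw [norm_mul, norm_div, norm_mul, norm_one, norm_natCast_add_ofReal ha,
    norm_natCast_add_ofReal ha, ← mul_assoc]
  have := hK j
  gcongr
  · exact (norm_nonneg _).trans this
  · simp

lemma norm_weight_diff_le {a : ℝ} (ha : 1 / 2 ≤ a) (u : ℕ → ℂ) (j : ℕ) :
    ‖(u j - u (j + 1)) / (((j + 1 : ℕ) : ℂ) + a)‖ ≤ ‖u (j + 1) - u j‖ / ((j : ℝ) + 1) := by
  rw [norm_div, norm_natCast_add_ofReal ha, norm_sub_rev]
  refine div_le_div_of_nonneg_left (norm_nonneg _) (by positivity) ?_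
  push_cast
  linarith

/-- The value of `∑ z^(j+1) u_j / (j+a)^r`, after summation by parts when `r = 1`. -/
noncomputable def abelValue (a : ℝ) (r : ℕ) (z : ℂ) (u : ℕ → ℂ) : ℂ :=
  if r = 1 then
    (∑' j : ℕ, (∑ l ∈ Finset.range (j + 1), z ^ (l + 1)) *
      (u j * (1 / (((j : ℂ) + a) * (((j + 1 : ℕ) : ℂ) + a)))))
    + ∑' j : ℕ, (∑ l ∈ Finset.range (j + 1), z ^ (l + 1)) *
      ((u j - u (j + 1)) / (((j + 1 : ℕ) : ℂ) + a))
  else ∑' j : ℕ, z ^ (j + 1) / ((j : ℂ) + a) ^ r * u j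

lemma tendsto_abelValue {a K : ℝ} (ha : 1 / 2 ≤ a) {r : ℕ} (hr : 1 ≤ r) {z : ℂ} (hz : ‖z‖ = 1)
    (hrz : (r, z) ≠ (1, 1)) {u : ℕ → ℂ} (hK : ∀ j, ‖u j‖ ≤ K * √((j : ℝ) + 1))
    (hs : Summable fun j : ℕ => ‖u (j + 1) - u j‖ / ((j : ℝ) + 1)) :
    Tendsto (fun J => ∑ j ∈ Finset.range J, z ^ (j + 1) / ((j : ℂ) + a) ^ r * u j) atTop
      (𝓝 (abelValue a r z u)) := by
  unfold abelValue
  split_ifs with h1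
  · subst h1
    have hz1 : z ≠ 1 := fun h => hrz (by rw [h])
    have hm : Summable fun j : ℕ => ‖u j * (1 / (((j : ℂ) + a) * (((j + 1 : ℕ) : ℂ) + a)))‖ :=
      Summable.of_nonneg_of_le (fun j => norm_nonneg _) (norm_weight_main_le ha hK)
        ((summable_sqrt_mul_weight ha).mul_left K)
    have hd : Summable fun j : ℕ => ‖(u j - u (j + 1)) / (((j + 1 : ℕ) : ℂ) + a)‖ :=
      Summable.of_nonneg_of_le (fun j => norm_nonneg _) (norm_weight_diff_le ha u) hs
    have hW : ∀ f : ℕ → ℂ, (Summable fun j => ‖f j‖) → Summable fun j =>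
        (∑ l ∈ Finset.range (j + 1), z ^ (l + 1)) * f j := fun f hf =>
      Summable.of_norm_bounded (hf.mul_left (2 / ‖z - 1‖)) fun j => by
        rw [norm_mul]
        gcongr
        exact norm_sum_pow_succ_le hz hz1 _
    have hg : Tendsto (fun j : ℕ => u j / ((j : ℂ) + a)) atTop (𝓝 0) := by
      refine squeeze_zero_norm (a := fun j : ℕ => 2 * K * (√((j : ℝ) + 1))⁻¹) (fun j => ?_) ?_
      · rw [norm_div, norm_natCast_add_ofReal ha, div_le_iff₀ (by positivity)]
        have hq := Real.mul_self_sqrt (show (0 : ℝ) ≤ (j : ℝ) + 1 by positivity)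
        have h0 : 0 < √((j : ℝ) + 1) := by positivity
        have hj : (0 : ℝ) ≤ j := by positivity
        have hK0 : 0 ≤ K := by
          have := (norm_nonneg _).trans (hK 0)
          simpa using this
        refine (hK j).trans ?_
        have e : √((j : ℝ) + 1) = (√((j : ℝ) + 1))⁻¹ * ((j : ℝ) + 1) := by
          field_simp
          nlinarith
        calc K * √((j : ℝ) + 1) = K * (√((j : ℝ) + 1))⁻¹ * ((j : ℝ) + 1) := by
              conv_lhs => rw [e]
              ring
          _ ≤ K * (√((j : ℝ) + 1))⁻¹ * (2 * ((j : ℝ) + a)) := by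
              gcongr
              linarith
          _ = _ := by ring
      · have h : Tendsto (fun j : ℕ => √((j : ℝ) + 1)) atTop atTop :=
          Real.tendsto_sqrt_atTop.comp (tendsto_atTop_add_const_right _ _
            tendsto_natCast_atTop_atTop)
        simpa using h.inv_tendsto_atTop.const_mul (2 * K)
    have h := tendsto_sum_pow_mul hz hz1 hg (by
      simp_rw [weight_sub_eq ha]
      exact Summable.of_nonneg_of_le (fun j => norm_nonneg _) (fun j => norm_add_le _ _)
        (hm.add hd))
    simp_rw [weight_sub_eq ha] at h
    rw [← (hW _ hm).tsum_add (hW _ hd)]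
    simp_rw [← mul_add (∑ l ∈ Finset.range _, z ^ (l + 1))]
    refine h.congr fun J => Finset.sum_congr rfl fun j _ => ?_
    rw [pow_one]; ring
  · refine (Summable.hasSum ?_).tendsto_sum_nat
    refine Summable.of_norm_bounded
      (((summable_sqrt_mul_weight ha).mul_left (2 ^ r * K))) fun j => ?_
    rw [norm_mul]
    calc _ ≤ 2 ^ r * (1 / (((j : ℝ) + a) * ((j : ℝ) + a))) * (K * √((j : ℝ) + 1)) := by
          gcongr
          · exact norm_weight_le ha hz (by omega) j
          · exact hK j
      _ = _ := by ring

/-- Continuity of `abelValue` along a sequence of coefficient functions. -/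
lemma tendsto_abelValue_of_pointwise {a K : ℝ} (ha : 1 / 2 ≤ a) {r : ℕ} (hr : 1 ≤ r) {z C : ℂ}
    (hz : ‖z‖ = 1) (hrz : (r, z) ≠ (1, 1)) {u : ℕ → ℕ → ℂ}
    (hK : ∀ M j, ‖u M j‖ ≤ K * √((j : ℝ) + 1)) (hC : ∀ j, Tendsto (fun M => u M j) atTop (𝓝 C))
    (hs : ∀ M, Summable fun j : ℕ => ‖u M (j + 1) - u M j‖ / ((j : ℝ) + 1))
    (hs0 : Tendsto (fun M => ∑' j : ℕ, ‖u M (j + 1) - u M j‖ / ((j : ℝ) + 1)) atTop (𝓝 0)) :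
    Tendsto (fun M => abelValue a r z (u M)) atTop (𝓝 (abelValue a r z fun _ => C)) := by
  unfold abelValue
  split_ifs with h1
  · subst h1
    have hz1 : z ≠ 1 := fun h => hrz (by rw [h])
    refine Tendsto.add ?_ ?_
    · refine tendsto_tsum_of_dominated_convergence
        (((summable_sqrt_mul_weight ha).mul_left (2 / ‖z - 1‖ * K))) (fun j => ?_)
        (Eventually.of_forall fun M j => ?_)
      · exact ((hC j).mul_const _).const_mul _
      · rw [norm_mul, mul_assoc]
        gcongr
        · exact norm_sum_pow_succ_le hz hz1 _
        · exact norm_weight_main_le ha (hK M) j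
    · simp only [sub_self, zero_div, mul_zero, tsum_zero]
      refine squeeze_zero_norm (fun M => ?_)
        (by simpa using hs0.const_mul (2 / ‖z - 1‖))
      refine tsum_of_norm_bounded ((hs M).hasSum.mul_left (2 / ‖z - 1‖)) fun j => ?_
      rw [norm_mul]
      gcongr
      · exact norm_sum_pow_succ_le hz hz1 _
      · exact norm_weight_diff_le ha (u M) j
  · refine tendsto_tsum_of_dominated_convergence
        (((summable_sqrt_mul_weight ha).mul_left (2 ^ r * K))) (fun j => ?_)
        (Eventually.of_forall fun M j => ?_)
    · exact (hC j).const_mul _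
    · rw [norm_mul]
      calc _ ≤ 2 ^ r * (1 / (((j : ℝ) + a) * ((j : ℝ) + a))) * (K * √((j : ℝ) + 1)) := by
            gcongr
            · exact norm_weight_le ha hz (by omega) j
            · exact hK M j
        _ = _ := by ring

lemma le_mul_sqrt_succ {K : ℝ} (hK : 0 ≤ K) (j : ℕ) : K ≤ K * √((j : ℝ) + 1) := by
  refine le_mul_of_one_le_right hK (Real.one_le_sqrt.2 ?_)
  linarith [(Nat.cast_nonneg j : (0 : ℝ) ≤ j)]

lemma tendsto_const_abelValue {a : ℝ} (ha : 1 / 2 ≤ a) {r : ℕ} (hr : 1 ≤ r) {z : ℂ}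
    (hz : ‖z‖ = 1) (hrz : (r, z) ≠ (1, 1)) (C : ℂ) :
    Tendsto (fun J => ∑ j ∈ Finset.range J, z ^ (j + 1) / ((j : ℂ) + a) ^ r * C) atTop
      (𝓝 (abelValue a r z fun _ => C)) :=
  tendsto_abelValue ha hr hz hrz (u := fun _ => C) (fun j => le_mul_sqrt_succ (norm_nonneg C) j)
    (by simp)

lemma converges_tSum {r : ℕ} (hr : 1 ≤ r) {z : ℂ} (hz : ‖z‖ = 1) (hrz : (r, z) ≠ (1, 1)) :
    Converges fun n => tSum n r z := by
  refine ⟨_, (tendsto_const_abelValue (a := 1 / 2) le_rfl hr hz hrz 1).congr fun J => ?_⟩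
  rw [tSum_eq_range]
  simp

lemma converges_zetaSum {r : ℕ} (hr : 1 ≤ r) {z : ℂ} (hz : ‖z‖ = 1) (hrz : (r, z) ≠ (1, 1)) :
    Converges fun n => zetaSum n r z := by
  refine ⟨_, (tendsto_const_abelValue (a := 1) (by norm_num) hr hz hrz 1).congr fun J => ?_⟩
  rw [zetaSum_eq_range]
  simp

lemma tendsto_tSum {r : ℕ} (hr : 1 ≤ r) {z : ℂ} (hz : ‖z‖ = 1) (hrz : (r, z) ≠ (1, 1)) :
    Tendsto (fun n => tSum n r z) atTop (𝓝 (ti r z)) :=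
  (converges_tSum hr hz hrz).tendsto_limUnder

lemma tendsto_zetaSum {r : ℕ} (hr : 1 ≤ r) {z : ℂ} (hz : ‖z‖ = 1) (hrz : (r, z) ≠ (1, 1)) :
    Tendsto (fun n => zetaSum n r z) atTop (𝓝 (Li r z)) :=
  (converges_zetaSum hr hz hrz).tendsto_limUnder

lemma abelValue_const {r : ℕ} (hr : 1 ≤ r) {z : ℂ} (hz : ‖z‖ = 1) (hrz : (r, z) ≠ (1, 1))
    (C : ℂ) : (abelValue (1 / 2) r z fun _ => C) = ti r z * C := by
  refine tendsto_nhds_unique (tendsto_const_abelValue le_rfl hr hz hrz C)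
    (((tendsto_tSum hr hz hrz).mul_const C).congr fun J => ?_)
  rw [tSum_eq_range, Finset.sum_mul]
  simp

lemma converges_stPartial {p q : ℕ} (hp : 1 ≤ p) (hq : 1 ≤ q) {y w : ℂ} (hy : ‖y‖ = 1)
    (hw : ‖w‖ = 1) (hpy : (p, y) ≠ (1, 1)) (hqw : (q, w) ≠ (1, 1)) :
    Converges fun M => stPartial M p q y w := by
  obtain ⟨K, hK⟩ := (Metric.isBounded_range_of_tendsto _ (tendsto_tSum hp hy hpy)).exists_norm_le
  have hK' : ∀ n, ‖tSum n p y‖ ≤ K := fun n => hK _ ⟨n, rfl⟩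
  have hK0 : 0 ≤ K := (norm_nonneg _).trans (hK' 0)
  refine ⟨_, (tendsto_abelValue (a := 1) (K := K) (by norm_num) hq hw hqw
    (u := fun j => tSum (j + 1) p y)
    (fun j => (hK' _).trans (le_mul_sqrt_succ hK0 j)) ?_).congr fun J => ?_⟩
  · refine Summable.of_nonneg_of_le (fun j => by positivity) (fun j => ?_)
      (((summable_nat_add_iff 1).2 (Real.summable_one_div_nat_pow.2 one_lt_two)).mul_left (2 ^ p))
    rw [tSum_eq_range, tSum_eq_range, Finset.sum_range_succ _ (j + 1), add_sub_cancel_left,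
      norm_div, norm_pow, norm_pow, hy, one_pow,
      show (((j + 1 : ℕ) : ℂ) + 1 / 2) = ((j + 1 : ℕ) : ℂ) + ((1 / 2 : ℝ) : ℂ) by push_cast; rfl,
      norm_natCast_add_ofReal le_rfl, div_div, mul_one_div,
      div_le_div_iff₀ (by positivity) (by positivity)]
    have h1 : (((j + 1 : ℕ) : ℝ)) ≤ (2 * (((j + 1 : ℕ) : ℝ) + 1 / 2)) ^ p := by
      have h2 : (0 : ℝ) ≤ ((j + 1 : ℕ) : ℝ) := by positivity
      exact (by linarith : ((j + 1 : ℕ) : ℝ) ≤ 2 * (((j + 1 : ℕ) : ℝ) + 1 / 2)).trans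
        (le_self_pow₀ (by linarith) (by omega))
    rw [mul_pow] at h1
    push_cast at h1 ⊢
    have h2 : (0 : ℝ) ≤ (j : ℝ) + 1 := by positivity
    nlinarith [mul_le_mul_of_nonneg_left h1 h2]
  · rw [stPartial_eq_range]
    simp

/-- The terms `x ^ (-k) / (k + 1/2) ^ i` of the bilateral series attached to `x`. -/
noncomputable def bilateralTerm (i : ℕ) (x : ℂ) (k : ℤ) : ℂ := x ^ (-k) / ((k : ℂ) + 1 / 2) ^ i

/-- The sum of `bilateralTerm i x k` over `j - M ≤ k ≤ j + M`. -/
noncomputable def window (i : ℕ) (x : ℂ) (M j : ℕ) : ℂ :=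
  bilateralTerm i x j + ∑ n ∈ Finset.range M,
    (bilateralTerm i x ((j : ℤ) + (n + 1 : ℕ)) + bilateralTerm i x ((j : ℤ) - (n + 1 : ℕ)))

lemma intCast_add_half_ne_zero (k : ℤ) : (k : ℝ) + 1 / 2 ≠ 0 := by
  intro h
  have h2 : (2 * k + 1 : ℝ) = 0 := by linarith
  have h3 : 2 * k + 1 = 0 := by exact_mod_cast h2
  omega

lemma half_le_abs_intCast_add_half (k : ℤ) : 1 / 2 ≤ |(k : ℝ) + 1 / 2| := by
  rcases le_or_gt 0 k with h | h
  · have : (0 : ℝ) ≤ k := by exact_mod_cast h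
    exact le_abs.2 (Or.inl (by linarith))
  · have : (k : ℝ) ≤ -1 := by exact_mod_cast (by omega : k ≤ -1)
    exact le_abs.2 (Or.inr (by linarith))

lemma norm_intCast_add_half (k : ℤ) : ‖(k : ℂ) + 1 / 2‖ = |(k : ℝ) + 1 / 2| := by
  rw [show (k : ℂ) + 1 / 2 = (((k : ℝ) + 1 / 2 : ℝ) : ℂ) by push_cast; rfl, Complex.norm_real,
    Real.norm_eq_abs]

lemma norm_bilateralTerm_le {i : ℕ} (hi : 1 ≤ i) {x : ℂ} (hx : ‖x‖ = 1) (k : ℤ) :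
    ‖bilateralTerm i x k‖ ≤ 2 ^ i * (1 / |(k : ℝ) + 1 / 2|) := by
  have hk := half_le_abs_intCast_add_half k
  obtain ⟨s, rfl⟩ := Nat.exists_eq_add_of_le hi
  rw [bilateralTerm, norm_div, norm_zpow, norm_pow, hx, one_zpow, norm_intCast_add_half]
  set t := |(k : ℝ) + 1 / 2|
  have ht : 0 < t := by linarith
  rw [mul_one_div, div_le_div_iff₀ (by positivity) ht, one_mul]
  have h1 : (1 : ℝ) ≤ (2 * t) ^ (1 + s) / (2 * t) := by
    rw [pow_add, pow_one, mul_div_cancel_left₀ _ (by positivity)]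
    exact one_le_pow₀ (by linarith)
  rw [le_div_iff₀ (by positivity), mul_pow] at h1
  linarith

lemma window_succ_sub (i : ℕ) (x : ℂ) (M j : ℕ) :
    window i x M (j + 1) - window i x M j =
      bilateralTerm i x ((j : ℤ) + (M + 1 : ℕ)) - bilateralTerm i x ((j : ℤ) - (M : ℕ)) := by
  induction M with
  | zero => simp [window]
  | succ M ih =>
    simp only [window] at ih ⊢
    rw [Finset.sum_range_succ, Finset.sum_range_succ,
      show ((j + 1 : ℕ) : ℤ) + (M + 1 : ℕ) = (j : ℤ) + (M + 1 + 1 : ℕ) by push_cast; ring,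
      show ((j + 1 : ℕ) : ℤ) - (M + 1 : ℕ) = (j : ℤ) - (M : ℕ) by push_cast; ring]
    linear_combination ih

lemma window_zero_right {x : ℂ} (hx : x ≠ 0) (i M : ℕ) :
    window i x M 0 = x * tSum (M + 1) i x⁻¹ + (-1) ^ i * tSum M i x := by
  rw [window, Finset.sum_add_distrib, tSum_eq_range, tSum_eq_range, Finset.sum_range_succ',
    mul_add, Finset.mul_sum, Finset.mul_sum]
  have h1 : ∀ n : ℕ, bilateralTerm i x (((0 : ℕ) : ℤ) + (n + 1 : ℕ)) =
      x * (x⁻¹ ^ (n + 1 + 1) / (((n + 1 : ℕ) : ℂ) + 1 / 2) ^ i) := by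
    intro n
    rw [bilateralTerm, Nat.cast_zero, zero_add, zpow_neg, zpow_natCast, inv_pow, Int.cast_natCast]
    field_simp
    ring
  have h2 : ∀ n : ℕ, bilateralTerm i x (((0 : ℕ) : ℤ) - (n + 1 : ℕ)) =
      (-1) ^ i * (x ^ (n + 1) / ((n : ℂ) + 1 / 2) ^ i) := by
    intro n
    rw [bilateralTerm, Nat.cast_zero, zero_sub, neg_neg, zpow_natCast,
      show (((-((n + 1 : ℕ) : ℤ) : ℤ) : ℂ) + 1 / 2) = -1 * ((n : ℂ) + 1 / 2) by push_cast; ring,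
      mul_pow]
    have : ((-1 : ℂ) ^ i) * (-1) ^ i = 1 := by rw [← mul_pow]; simp
    have h3 : ((-1 : ℂ) ^ i)⁻¹ = (-1) ^ i := inv_eq_of_mul_eq_one_left this
    rw [div_mul_eq_div_div, div_eq_mul_inv (x ^ (n + 1)) ((-1) ^ i), h3]
    ring
  simp_rw [h1, h2]
  have h3 : bilateralTerm i x ((0 : ℕ) : ℤ) = x * (x⁻¹ ^ (0 + 1) / (((0 : ℕ) : ℂ) + 1 / 2) ^ i) := by
    simp [bilateralTerm]
    field_simp
  rw [h3]
  ring

/-- The limit of `window i x M j` as `M → ∞`. -/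
noncomputable def bilateralSum (i : ℕ) (x : ℂ) : ℂ := x * ti i x⁻¹ + (-1) ^ i * ti i x

lemma tendsto_window_zero_right {i : ℕ} (hi : 1 ≤ i) {x : ℂ} (hx : ‖x‖ = 1) :
    Tendsto (fun M => window i x M 0) atTop (𝓝 (bilateralSum i x)) := by
  have hx0 : x ≠ 0 := norm_ne_zero_iff.1 (by rw [hx]; norm_num)
  simp_rw [window_zero_right hx0, bilateralSum]
  by_cases h : (i, x) = (1, 1)
  · obtain ⟨rfl, rfl⟩ := Prod.mk.inj h
    have h1 : ∀ M : ℕ, (1 : ℂ) * tSum (M + 1) 1 1⁻¹ + (-1) ^ 1 * tSum M 1 1 =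
        ((M : ℂ) + 1 / 2)⁻¹ := by
      intro M
      rw [tSum_eq_range, tSum_eq_range, Finset.sum_range_succ]
      simp
    simp_rw [h1]
    have h2 : Tendsto (fun M : ℕ => ‖(M : ℂ) + 1 / 2‖) atTop atTop := by
      refine tendsto_atTop_mono (fun M => ?_) tendsto_natCast_atTop_atTop
      have := norm_natCast_add_ofReal (a := 1 / 2) le_rfl M
      push_cast at this
      rw [this]
      linarith
    have h3 : (1 : ℂ) * ti 1 1⁻¹ + (-1) ^ 1 * ti 1 1 = 0 := by simp
    rw [h3]
    exact tendsto_inv₀_cobounded.comp (tendsto_norm_atTop_iff_cobounded.1 h2)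
  · have h' : (i, x⁻¹) ≠ (1, 1) := fun e => h (by simpa using e)
    exact (((tendsto_tSum hi (by simp [hx]) h').comp (tendsto_add_atTop_nat 1)).const_mul _).add
      ((tendsto_tSum hi hx h).const_mul _)

lemma tendsto_bilateralTerm {i : ℕ} (hi : 1 ≤ i) {x : ℂ} (hx : ‖x‖ = 1) {k : ℕ → ℤ}
    (hk : Function.Injective k) : Tendsto (fun n => bilateralTerm i x (k n)) atTop (𝓝 0) := by
  refine squeeze_zero_norm (fun n => norm_bilateralTerm_le hi hx (k n)) ?_
  have h := (summable_one_div_int_sq.comp_injective hk).tendsto_atTop_zero.sqrt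
  simp only [Function.comp_def, Real.sqrt_zero] at h
  have h2 : ∀ n, √((1 / |(k n : ℝ) + 1 / 2|) ^ 2) = 1 / |(k n : ℝ) + 1 / 2| :=
    fun n => Real.sqrt_sq (by positivity)
  simp_rw [h2] at h
  simpa using h.const_mul (2 ^ i)

lemma tendsto_window {i : ℕ} (hi : 1 ≤ i) {x : ℂ} (hx : ‖x‖ = 1) (j : ℕ) :
    Tendsto (fun M => window i x M j) atTop (𝓝 (bilateralSum i x)) := by
  induction j with
  | zero => exact tendsto_window_zero_right hi hx
  | succ j ih =>
    have h1 := tendsto_bilateralTerm hi hx (k := fun M : ℕ => (j : ℤ) + (M + 1 : ℕ))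
      (fun a b h => by simpa using h)
    have h2 := tendsto_bilateralTerm hi hx (k := fun M : ℕ => (j : ℤ) - (M : ℕ))
      (fun a b h => by simpa using h)
    have h := ih.add (h1.sub h2)
    simp only [sub_self, add_zero] at h
    refine h.congr fun M => ?_
    rw [← window_succ_sub]
    ring

lemma sum_one_div_abs_le {k : ℕ → ℤ} (hk : Function.Injective k) (J : ℕ) :
    ∑ l ∈ Finset.range J, 1 / |(k l : ℝ) + 1 / 2| ≤
      √(∑' n : ℤ, (1 / |(n : ℝ) + 1 / 2|) ^ 2) * √((J : ℝ) + 1) := by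
  rw [← Real.sqrt_mul (tsum_nonneg fun n => by positivity)]
  refine Real.le_sqrt_of_sq_le ((sq_sum_le_card_mul_sum_sq).trans ?_)
  rw [Finset.card_range, mul_comm]
  have h := (summable_one_div_int_sq.comp_injective hk).sum_le_tsum (Finset.range J)
    (fun l _ => sq_nonneg _)
  have h2 := tsum_comp_le_tsum_of_inj summable_one_div_int_sq (fun n => by positivity) hk
  simp only [Function.comp_def] at h h2
  exact mul_le_mul (h.trans h2) (by linarith) (by positivity) (tsum_nonneg fun n => sq_nonneg _)

lemma exists_norm_window_le {i : ℕ} (hi : 1 ≤ i) {x : ℂ} (hx : ‖x‖ = 1) :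
    ∃ K, ∀ M j, ‖window i x M j‖ ≤ K * √((j : ℝ) + 1) := by
  obtain ⟨K, hK⟩ := (Metric.isBounded_range_of_tendsto _
    (tendsto_window_zero_right hi hx)).exists_norm_le
  have hK' : ∀ M, ‖window i x M 0‖ ≤ K := fun n => hK _ ⟨n, rfl⟩
  have hK0 : 0 ≤ K := (norm_nonneg _).trans (hK' 0)
  set E := √(∑' n : ℤ, (1 / |(n : ℝ) + 1 / 2|) ^ 2)
  refine ⟨K + (2 ^ i * E + 2 ^ i * E), fun M j => ?_⟩
  have h : ‖window i x M j‖ ≤ K +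
      (2 ^ i * ∑ l ∈ Finset.range j, 1 / |(((l : ℤ) + (M + 1 : ℕ) : ℤ) : ℝ) + 1 / 2|
      + 2 ^ i * ∑ l ∈ Finset.range j, 1 / |(((l : ℤ) - (M : ℕ) : ℤ) : ℝ) + 1 / 2|) := by
    have h1 : window i x M j = window i x M 0 + ∑ l ∈ Finset.range j,
        (window i x M (l + 1) - window i x M l) := by
      rw [Finset.sum_range_sub]; ring
    rw [h1]
    refine (norm_add_le _ _).trans (add_le_add (hK' M) ?_)
    refine (norm_sum_le _ _).trans ?_
    rw [Finset.mul_sum, Finset.mul_sum, ← Finset.sum_add_distrib]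
    refine Finset.sum_le_sum fun l _ => ?_
    rw [window_succ_sub]
    exact (norm_sub_le _ _).trans
      (add_le_add (norm_bilateralTerm_le hi hx _) (norm_bilateralTerm_le hi hx _))
  refine h.trans ?_
  rw [add_mul, add_mul, mul_assoc]
  refine add_le_add (le_mul_sqrt_succ hK0 j) (add_le_add ?_ ?_)
  · gcongr
    exact sum_one_div_abs_le (fun a b h => by simpa using h) j
  · gcongr
    exact sum_one_div_abs_le (fun a b h => by simpa using h) j

lemma one_div_mul_le {a b N : ℝ} (ha : 0 < a) (hb : 0 < b) (hN : 0 < N) (h : N ≤ a + b) :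
    1 / b / a ≤ 1 / √N * (1 / (a * √a) + 1 / (b * √b)) := by
  have key : ∀ c, 0 < c → c ≤ a + b → 1 / (c * (a + b)) ≤ 1 / √N * (1 / (c * √c)) := by
    intro c hc hcs
    rw [one_div_mul_one_div]
    refine one_div_le_one_div_of_le (by positivity) ?_
    have : √N * √c ≤ a + b := by
      rw [← Real.sqrt_mul hN.le]
      exact Real.sqrt_le_iff.2 ⟨by positivity, by nlinarith⟩
    nlinarith
  have e : 1 / b / a = 1 / (a * (a + b)) + 1 / (b * (a + b)) := by
    field_simp
    ring
  rw [e, mul_add (1 / √N)]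
  exact add_le_add (key a ha (by linarith)) (key b hb (by linarith))

/-- A bound for `∑ 1 / ((j + 1) |k_j + 1/2|)` when `(j + 1) + |k_j + 1/2| ≥ N`. -/
lemma exists_tsum_one_div_le :
    ∃ B : ℝ, ∀ (k : ℕ → ℤ) (N : ℝ), Function.Injective k → 0 < N →
      (∀ j : ℕ, N ≤ ((j : ℝ) + 1) + |(k j : ℝ) + 1 / 2|) →
      Summable (fun j : ℕ => 1 / |(k j : ℝ) + 1 / 2| / ((j : ℝ) + 1)) ∧
      ∑' j : ℕ, 1 / |(k j : ℝ) + 1 / 2| / ((j : ℝ) + 1) ≤ 1 / √N * B := by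
  refine ⟨∑' j : ℕ, 1 / (((j : ℝ) + 1) * √((j : ℝ) + 1)) +
    ∑' n : ℤ, 1 / (|(n : ℝ) + 1 / 2| * √|(n : ℝ) + 1 / 2|), fun k N hk hN h => ?_⟩
  have hle : ∀ j : ℕ, 1 / |(k j : ℝ) + 1 / 2| / ((j : ℝ) + 1) ≤
      1 / √N * (1 / (((j : ℝ) + 1) * √((j : ℝ) + 1)) +
        1 / (|(k j : ℝ) + 1 / 2| * √|(k j : ℝ) + 1 / 2|)) := fun j =>
    one_div_mul_le (by positivity) (abs_pos.2 (intCast_add_half_ne_zero _)) hN (h j)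
  have hs := summable_one_div_int_mul_sqrt.comp_injective hk
  have hs2 := tsum_comp_le_tsum_of_inj summable_one_div_int_mul_sqrt (fun n => by positivity) hk
  simp only [Function.comp_def] at hs hs2
  have hsum := (summable_one_div_succ_mul_sqrt.add hs).mul_left (1 / √N)
  have hS := Summable.of_nonneg_of_le (fun j => by positivity) hle hsum
  refine ⟨hS, (hS.tsum_le_tsum hle hsum).trans ?_⟩
  rw [tsum_mul_left, summable_one_div_succ_mul_sqrt.tsum_add hs]
  gcongr

lemma window_increments {i : ℕ} (hi : 1 ≤ i) {x : ℂ} (hx : ‖x‖ = 1) :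
    (∀ M, Summable fun j : ℕ => ‖window i x M (j + 1) - window i x M j‖ / ((j : ℝ) + 1)) ∧
    Tendsto (fun M => ∑' j : ℕ, ‖window i x M (j + 1) - window i x M j‖ / ((j : ℝ) + 1)) atTop
      (𝓝 0) := by
  obtain ⟨B, hB⟩ := exists_tsum_one_div_le
  have h1 := fun M : ℕ => hB (fun j => (j : ℤ) + (M + 1 : ℕ)) ((M : ℝ) + 1 / 2)
    (fun a b h => by simpa using h) (by positivity) (fun j => by
      have := le_abs_self ((((j : ℤ) + (M + 1 : ℕ) : ℤ) : ℝ) + 1 / 2)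
      push_cast at this ⊢
      have : (0 : ℝ) ≤ j := by positivity
      linarith)
  have h2 := fun M : ℕ => hB (fun j => (j : ℤ) - (M : ℕ)) ((M : ℝ) + 1 / 2)
    (fun a b h => by simpa using h) (by positivity) (fun j => by
      have := neg_le_abs ((((j : ℤ) - (M : ℕ) : ℤ) : ℝ) + 1 / 2)
      push_cast at this ⊢
      linarith)
  have hle : ∀ M j : ℕ, ‖window i x M (j + 1) - window i x M j‖ / ((j : ℝ) + 1) ≤
      2 ^ i * (1 / |(((j : ℤ) + (M + 1 : ℕ) : ℤ) : ℝ) + 1 / 2| / ((j : ℝ) + 1) +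
        1 / |(((j : ℤ) - (M : ℕ) : ℤ) : ℝ) + 1 / 2| / ((j : ℝ) + 1)) := by
    intro M j
    rw [window_succ_sub, ← add_div, ← mul_div_assoc, mul_add]
    gcongr
    exact (norm_sub_le _ _).trans
      (add_le_add (norm_bilateralTerm_le hi hx _) (norm_bilateralTerm_le hi hx _))
  have hsum := fun M => ((h1 M).1.add (h2 M).1).mul_left (2 ^ i)
  have hS := fun M => Summable.of_nonneg_of_le (fun j => by positivity) (hle M) (hsum M)
  refine ⟨hS, ?_⟩
  have hN : Tendsto (fun M : ℕ => 1 / √((M : ℝ) + 1 / 2)) atTop (𝓝 0) := by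
    simp_rw [one_div (√_)]
    exact (Real.tendsto_sqrt_atTop.comp (tendsto_atTop_add_const_right _ _
      tendsto_natCast_atTop_atTop)).inv_tendsto_atTop
  refine squeeze_zero (fun M => tsum_nonneg fun j => by positivity)
    (fun M => ((hS M).tsum_le_tsum (hle M) (hsum M)).trans ?_)
    (show Tendsto (fun M : ℕ => (2 : ℝ) ^ i * (1 / √((M : ℝ) + 1 / 2) * B +
      1 / √((M : ℝ) + 1 / 2) * B)) atTop (𝓝 0) by
      simpa using ((hN.mul_const B).add (hN.mul_const B)).const_mul (2 ^ i))
  rw [tsum_mul_left, (h1 M).1.tsum_add (h2 M).1]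
  gcongr
  · exact (h1 M).2
  · exact (h2 M).2

/-- The weighted sums of windows converge, and so do their limits as the window grows. -/
lemma exists_tendsto_sum_window {i r : ℕ} (hi : 1 ≤ i) (hr : 1 ≤ r) {x z : ℂ} (hx : ‖x‖ = 1)
    (hz : ‖z‖ = 1) (hrz : (r, z) ≠ (1, 1)) :
    ∃ S : ℕ → ℂ,
      (∀ M, Tendsto (fun J => ∑ j ∈ Finset.range J,
        z ^ (j + 1) / ((j : ℂ) + 1 / 2) ^ r * window i x M j) atTop (𝓝 (S M))) ∧
      Tendsto S atTop (𝓝 (ti r z * bilateralSum i x)) := by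
  obtain ⟨K, hK⟩ := exists_norm_window_le hi hx
  obtain ⟨h1, h2⟩ := window_increments hi hx
  refine ⟨fun M => abelValue (1 / 2) r z (window i x M), fun M => ?_, ?_⟩
  · simpa using tendsto_abelValue (a := 1 / 2) le_rfl hr hz hrz (hK M) (h1 M)
  · rw [← abelValue_const hr hz hrz]
    exact tendsto_abelValue_of_pointwise le_rfl hr hz hrz hK (tendsto_window hi hx) h1 h2

/-- One half of the partial fraction expansion of `α ^ q * β ^ p` when `α β = δ (α - β)`. -/
noncomputable def partialFraction (p q : ℕ) (δ α : ℂ) : ℂ :=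
  ∑ s ∈ Finset.range q, ((p + s - 1).choose s : ℂ) * (-1) ^ s * δ ^ (p + s) * α ^ (q - s)

lemma partialFraction_succ_succ (p q : ℕ) (δ α : ℂ) :
    partialFraction (p + 1) (q + 1) δ α =
      δ * (partialFraction p (q + 1) δ α - partialFraction (p + 1) q δ α) := by
  simp only [partialFraction]
  rw [Finset.sum_range_succ', Finset.sum_range_succ' _ q, mul_sub, mul_add, Finset.mul_sum,
    Finset.mul_sum, add_sub_right_comm, ← Finset.sum_sub_distrib]
  congr 1
  · refine Finset.sum_congr rfl fun s _ => ?_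
    rw [show p + 1 + (s + 1) - 1 = (p + s) + 1 by omega, Nat.choose_succ_succ,
      show p + (s + 1) - 1 = p + s by omega, show p + 1 + s - 1 = p + s by omega,
      show q + 1 - (s + 1) = q - s by omega]
    push_cast
    ring
  · simp
    ring

lemma partialFraction_zero_left (q : ℕ) (δ α : ℂ) :
    partialFraction 0 (q + 1) δ α = α ^ (q + 1) := by
  rw [partialFraction, Finset.sum_range_succ', Finset.sum_eq_zero]
  · simp
  · intro s _
    rw [Nat.choose_eq_zero_of_lt (by omega)]
    simp

lemma partialFraction_zero_right (p : ℕ) (δ α : ℂ) : partialFraction p 0 δ α = 0 := by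
  simp [partialFraction]

lemma partialFraction_add (δ α β : ℂ) (h : α * β = δ * (α - β)) (p q : ℕ) (hpq : p + q ≠ 0) :
    partialFraction p q δ α + partialFraction q p (-δ) β = α ^ q * β ^ p := by
  induction p generalizing q with
  | zero =>
    obtain ⟨q, rfl⟩ := Nat.exists_eq_succ_of_ne_zero (by omega : q ≠ 0)
    simp [partialFraction_zero_left, partialFraction_zero_right]
  | succ p ihp =>
    induction q with
    | zero => simp [partialFraction_zero_left, partialFraction_zero_right]
    | succ q ihq =>
      rw [partialFraction_succ_succ, partialFraction_succ_succ]
      linear_combination δ * ihp (q + 1) (by omega) - δ * ihq (by omega) - α ^ q * β ^ p * h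

lemma partialFraction_reflect {p q : ℕ} (hp : 1 ≤ p) (δ α : ℂ) :
    partialFraction p q δ α = ∑ m ∈ Finset.range q, ((p + q - m - 2).choose (p - 1) : ℂ) *
      (-1) ^ (q - 1 - m) * δ ^ (p + q - m - 1) * α ^ (m + 1) := by
  rw [partialFraction, ← Finset.sum_range_reflect]
  refine Finset.sum_congr rfl fun m hm => ?_
  have hm := Finset.mem_range.1 hm
  rw [show p + (q - 1 - m) - 1 = p + q - m - 2 by omega,
    show p + (q - 1 - m) = p + q - m - 1 by omega, show q - (q - 1 - m) = m + 1 by omega,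
    ← Nat.choose_symm (by omega : p - 1 ≤ p + q - m - 2),
    show p + q - m - 2 - (p - 1) = q - 1 - m by omega]

/-- Partial fractions of `1 / (a ^ q * (a + d) ^ p)`. -/
lemma one_div_pow_mul_pow_eq {p q : ℕ} (hp : 1 ≤ p) (hq : 1 ≤ q) {a d : ℂ} (ha : a ≠ 0)
    (hd : d ≠ 0) (had : a + d ≠ 0) :
    1 / (a ^ q * (a + d) ^ p) =
      ∑ m ∈ Finset.range q, ((p + q - m - 2).choose (p - 1) : ℂ) *
        (-1) ^ (q - 1 - m) * (1 / d ^ (p + q - m - 1)) * (1 / a ^ (m + 1))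
      + (-1) ^ q * ∑ m ∈ Finset.range p, ((p + q - m - 2).choose (q - 1) : ℂ) *
        (1 / d ^ (p + q - m - 1)) * (1 / (a + d) ^ (m + 1)) := by
  have h := partialFraction_add (1 / d) (1 / a) (1 / (a + d)) (by field_simp; ring) p q (by omega)
  rw [partialFraction_reflect hp, partialFraction_reflect hq] at h
  simp only [one_div_pow] at h
  rw [← one_div_mul_one_div, ← h, Finset.mul_sum]
  congr 1
  refine Finset.sum_congr rfl fun m hm => ?_
  have hm := Finset.mem_range.1 hm
  rw [show q + p - m - 2 = p + q - m - 2 by omega, show q + p - m - 1 = p + q - m - 1 by omega,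
    neg_pow (1 / d), one_div_pow, show p + q - m - 1 = (p - 1 - m) + q by omega, pow_add (-1 : ℂ)]
  have : ((-1 : ℂ) ^ (p - 1 - m)) * (-1) ^ (p - 1 - m) = 1 := by
    rw [← mul_pow]; simp
  linear_combination (-1) ^ q *
    ((p + q - m - 2).choose (q - 1) : ℂ) * (1 / d ^ (p - 1 - m + q)) *
    (1 / (a + d) ^ (m + 1)) * this

lemma sum_choose_eq {p q : ℕ} (hp : 1 ≤ p) (hq : 1 ≤ q) :
    ∑ m ∈ Finset.range p, (p + q - m - 2).choose (q - 1) = (p + q - 1).choose (p - 1) := by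
  obtain ⟨p, rfl⟩ := Nat.exists_eq_add_of_le' hp
  obtain ⟨q, rfl⟩ := Nat.exists_eq_add_of_le' hq
  rw [← Finset.sum_range_reflect,
    ← Nat.choose_symm (by omega : p + 1 - 1 ≤ p + 1 + (q + 1) - 1),
    show p + 1 + (q + 1) - 1 - (p + 1 - 1) = q + 1 by omega,
    show p + 1 + (q + 1) - 1 = p + q + 1 by omega, ← Nat.sum_range_add_choose]
  refine Finset.sum_congr rfl fun m hm => ?_
  have hm := Finset.mem_range.1 hm
  congr 1
  omega

lemma one_div_neg_pow (a : ℂ) (i : ℕ) : 1 / (-a) ^ i = (-1) ^ i * (1 / a ^ i) := by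
  have h : (1 : ℂ) / (-1) ^ i = (-1) ^ i := by
    rw [div_eq_iff (pow_ne_zero _ (by norm_num)), ← mul_pow]
    simp
  rw [neg_pow, ← one_div_mul_one_div, h]

lemma natCast_add_half_ne_zero (j : ℕ) : (j : ℂ) + 1 / 2 ≠ 0 := by
  have := natCast_add_ofReal_ne_zero (a := 1 / 2) le_rfl j
  push_cast at this
  exact this

/-- Tails of the series of `ti p y`. -/
lemma tendsto_sum_shift {p : ℕ} (hp : 1 ≤ p) {y : ℂ} (hy : ‖y‖ = 1) (hpy : (p, y) ≠ (1, 1))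
    (n : ℕ) :
    Tendsto (fun J => ∑ j ∈ Finset.range J, y ^ (j + 1) * (1 / ((n : ℂ) + (j + 1 / 2)) ^ p)) atTop
      (𝓝 (y⁻¹ ^ n * (ti p y - tSum n p y))) := by
  have hy0 : y ≠ 0 := norm_ne_zero_iff.1 (by rw [hy]; norm_num)
  have h := ((((tendsto_tSum hp hy hpy).comp (tendsto_add_atTop_nat n)).sub_const
    (tSum n p y)).const_mul (y⁻¹ ^ n))
  refine h.congr fun J => ?_
  rw [Function.comp_apply, tSum_eq_range, tSum_eq_range, add_comm J n, Finset.sum_range_add,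
    add_sub_cancel_left, Finset.mul_sum]
  refine Finset.sum_congr rfl fun j _ => ?_
  rw [add_assoc n j 1, pow_add, Nat.cast_add, add_assoc, inv_pow]
  field_simp

/-- Extensions of the series of `ti p y` to finitely many negative indices. -/
lemma tendsto_sum_shift_neg {p : ℕ} (hp : 1 ≤ p) {y : ℂ} (hy : ‖y‖ = 1)
    (hpy : (p, y) ≠ (1, 1)) (n : ℕ) :
    Tendsto (fun J => ∑ j ∈ Finset.range J, y ^ (j + 1) * (1 / (-(n : ℂ) + (j + 1 / 2)) ^ p))
      atTop (𝓝 (y ^ n * (ti p y + (-1) ^ p * y * tSum n p y⁻¹))) := by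
  have hy0 : y ≠ 0 := norm_ne_zero_iff.1 (by rw [hy]; norm_num)
  rw [← tendsto_add_atTop_iff_nat n]
  have h := ((tendsto_tSum hp hy hpy).add_const ((-1) ^ p * y * tSum n p y⁻¹)).const_mul (y ^ n)
  refine h.congr fun J => ?_
  rw [tSum_eq_range, tSum_eq_range, add_comm J n, Finset.sum_range_add, add_comm (∑ j ∈ _, _),
    mul_add, Finset.mul_sum, Finset.mul_sum, Finset.mul_sum]
  congr 1
  · rw [← Finset.sum_range_reflect]
    refine Finset.sum_congr rfl fun j hj => ?_
    have hj := Finset.mem_range.1 hj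
    obtain ⟨k, rfl⟩ := Nat.exists_eq_add_of_lt hj
    rw [show j + k + 1 - 1 - j = k by omega, show -((j + k + 1 : ℕ) : ℂ) + ((j : ℂ) + 1 / 2) =
      -((k : ℂ) + 1 / 2) by push_cast; ring, one_div_neg_pow, inv_pow]
    have := natCast_add_half_ne_zero k
    field_simp
    ring
  · refine Finset.sum_congr rfl fun j _ => ?_
    rw [show -(n : ℂ) + (((n + j : ℕ) : ℂ) + 1 / 2) = (j : ℂ) + 1 / 2 by push_cast; ring]
    ring

/-- The sum of `x ^ (-n) / (n ^ q * (n + j + 1/2) ^ p)` over `0 < |n| ≤ M`. -/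
noncomputable def doubleKernel (p q : ℕ) (x : ℂ) (M j : ℕ) : ℂ :=
  ∑ n ∈ Finset.range M,
    (x⁻¹ ^ (n + 1) * (1 / (((n + 1 : ℕ) : ℂ) ^ q * (((n + 1 : ℕ) : ℂ) + (j + 1 / 2)) ^ p)) +
    x ^ (n + 1) * (1 / ((-((n + 1 : ℕ) : ℂ)) ^ q * (-((n + 1 : ℕ) : ℂ) + (j + 1 / 2)) ^ p)))

/-- The part of the Euler sums that is left after the products of single sums are removed. -/
noncomputable def remainder (p q : ℕ) (x y : ℂ) (M : ℕ) : ℂ :=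
  ∑ n ∈ Finset.range M,
    ((x * y)⁻¹ ^ (n + 1) * (1 / ((n + 1 : ℕ) : ℂ) ^ q) * (ti p y - tSum (n + 1) p y) +
    (x * y) ^ (n + 1) * ((-1) ^ q * (1 / ((n + 1 : ℕ) : ℂ) ^ q)) *
      (ti p y + (-1) ^ p * y * tSum (n + 1) p y⁻¹))

lemma tendsto_sum_doubleKernel {p : ℕ} (hp : 1 ≤ p) (q : ℕ) (x : ℂ) {y : ℂ} (hy : ‖y‖ = 1)
    (hpy : (p, y) ≠ (1, 1)) (M : ℕ) :
    Tendsto (fun J => ∑ j ∈ Finset.range J, y ^ (j + 1) * doubleKernel p q x M j) atTop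
      (𝓝 (remainder p q x y M)) := by
  have h : Tendsto (fun J => ∑ n ∈ Finset.range M,
      (x⁻¹ ^ (n + 1) * (1 / ((n + 1 : ℕ) : ℂ) ^ q) * (∑ j ∈ Finset.range J,
        y ^ (j + 1) * (1 / (((n + 1 : ℕ) : ℂ) + (j + 1 / 2)) ^ p)) +
      x ^ (n + 1) * (1 / (-((n + 1 : ℕ) : ℂ)) ^ q) * (∑ j ∈ Finset.range J,
        y ^ (j + 1) * (1 / (-((n + 1 : ℕ) : ℂ) + (j + 1 / 2)) ^ p)))) atTop
      (𝓝 (remainder p q x y M)) := by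
    refine tendsto_finsetSum _ fun n _ => ?_
    rw [mul_inv, mul_pow, mul_pow, ← one_div_neg_pow]
    convert ((tendsto_sum_shift hp hy hpy (n + 1)).const_mul
      (x⁻¹ ^ (n + 1) * (1 / ((n + 1 : ℕ) : ℂ) ^ q))).add
      ((tendsto_sum_shift_neg hp hy hpy (n + 1)).const_mul
      (x ^ (n + 1) * (1 / (-((n + 1 : ℕ) : ℂ)) ^ q))) using 2
    ring
  refine h.congr fun J => ?_
  simp only [doubleKernel, Finset.mul_sum, ← Finset.sum_add_distrib]
  rw [Finset.sum_comm]
  refine Finset.sum_congr rfl fun j _ => Finset.sum_congr rfl fun n _ => ?_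
  rw [← one_div_mul_one_div, ← one_div_mul_one_div]
  ring

lemma sum_eq_window {x : ℂ} (hx : x ≠ 0) (i M j : ℕ) :
    ∑ n ∈ Finset.range M, (x⁻¹ ^ (n + 1) * (1 / (((n + 1 : ℕ) : ℂ) + (j + 1 / 2)) ^ i) +
      x ^ (n + 1) * (1 / (-((n + 1 : ℕ) : ℂ) + (j + 1 / 2)) ^ i)) =
    x ^ j * window i x M j - 1 / ((j : ℂ) + 1 / 2) ^ i := by
  rw [window, mul_add, Finset.mul_sum]
  have h0 : x ^ j * bilateralTerm i x (j : ℤ) = 1 / ((j : ℂ) + 1 / 2) ^ i := by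
    rw [bilateralTerm, zpow_neg, zpow_natCast, Int.cast_natCast]
    field_simp
  rw [h0, add_sub_cancel_left]
  refine Finset.sum_congr rfl fun n _ => ?_
  rw [mul_add, bilateralTerm, bilateralTerm, neg_add, neg_sub, zpow_add₀ hx, zpow_sub₀ hx,
    zpow_neg, zpow_neg, zpow_natCast, zpow_natCast, Int.cast_add, Int.cast_sub, Int.cast_natCast,
    Int.cast_natCast, inv_pow, show (j : ℂ) + ((n + 1 : ℕ) : ℂ) + 1 / 2 =
      ((n + 1 : ℕ) : ℂ) + (j + 1 / 2) by ring,
    show (j : ℂ) - ((n + 1 : ℕ) : ℂ) + 1 / 2 = -((n + 1 : ℕ) : ℂ) + (j + 1 / 2) by ring]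
  congr 1 <;> field_simp

lemma sum_eq_zetaSum (i M : ℕ) (x : ℂ) :
    ∑ n ∈ Finset.range M, (x⁻¹ ^ (n + 1) * (1 / ((n + 1 : ℕ) : ℂ) ^ i) +
      x ^ (n + 1) * (1 / (-((n + 1 : ℕ) : ℂ)) ^ i)) =
    zetaSum M i x⁻¹ + (-1) ^ i * zetaSum M i x := by
  rw [zetaSum_eq_range, zetaSum_eq_range, Finset.mul_sum, ← Finset.sum_add_distrib]
  refine Finset.sum_congr rfl fun n _ => ?_
  rw [one_div_neg_pow]
  push_cast
  ring

lemma doubleKernel_eq {p q : ℕ} (hp : 1 ≤ p) (hq : 1 ≤ q) {x : ℂ} (hx : x ≠ 0) (M j : ℕ) :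
    doubleKernel p q x M j =
      ∑ m ∈ Finset.range q, ((p + q - m - 2).choose (p - 1) : ℂ) * (-1) ^ (q - 1 - m) *
        (1 / ((j : ℂ) + 1 / 2) ^ (p + q - m - 1)) *
          (zetaSum M (m + 1) x⁻¹ + (-1) ^ (m + 1) * zetaSum M (m + 1) x)
      + (-1) ^ q * ∑ m ∈ Finset.range p, ((p + q - m - 2).choose (q - 1) : ℂ) *
        (1 / ((j : ℂ) + 1 / 2) ^ (p + q - m - 1)) *
          (x ^ j * window (m + 1) x M j - 1 / ((j : ℂ) + 1 / 2) ^ (m + 1)) := by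
  have hd := natCast_add_half_ne_zero j
  have hpos : ∀ n : ℕ, ((n + 1 : ℕ) : ℂ) + (j + 1 / 2) ≠ 0 := fun n => by
    have := natCast_add_half_ne_zero (n + 1 + j)
    rw [Nat.cast_add, add_assoc] at this
    exact this
  have hneg : ∀ n : ℕ, -((n + 1 : ℕ) : ℂ) + (j + 1 / 2) ≠ 0 := fun n => by
    have := norm_intCast_add_half ((j : ℤ) - (n + 1 : ℕ))
    have h2 := half_le_abs_intCast_add_half ((j : ℤ) - (n + 1 : ℕ))
    rw [← this] at h2
    have h3 := norm_pos_iff.1 (lt_of_lt_of_le (by norm_num) h2)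
    intro h
    apply h3
    rw [← h]
    push_cast
    ring
  have hn : ∀ n : ℕ, ((n + 1 : ℕ) : ℂ) ≠ 0 := fun n => Nat.cast_ne_zero.2 (by omega)
  rw [doubleKernel]
  simp only [one_div_pow_mul_pow_eq hp hq (hn _) hd (hpos _),
    one_div_pow_mul_pow_eq hp hq (neg_ne_zero.2 (hn _)) hd (hneg _), ← sum_eq_window hx,
    ← sum_eq_zetaSum]
  simp only [mul_add, Finset.mul_sum, Finset.sum_add_distrib]
  rw [Finset.sum_comm (s := Finset.range q), Finset.sum_comm (s := Finset.range p),
    Finset.sum_comm (s := Finset.range q), Finset.sum_comm (s := Finset.range p)]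
  rw [add_add_add_comm]
  congr 2 <;>
    exact Finset.sum_congr rfl fun n _ => Finset.sum_congr rfl fun m _ => by ring

lemma tendsto_zetaSum_add {i : ℕ} (hi : 1 ≤ i) {x : ℂ} (hx : ‖x‖ = 1) :
    Tendsto (fun M => zetaSum M i x⁻¹ + (-1) ^ i * zetaSum M i x) atTop
      (𝓝 (Li i x⁻¹ + (-1) ^ i * Li i x)) := by
  by_cases h : (i, x) = (1, 1)
  · obtain ⟨rfl, rfl⟩ := Prod.mk.inj h
    simp
  · have h' : (i, x⁻¹) ≠ (1, 1) := fun e => h (by simpa using e)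
    exact (tendsto_zetaSum hi (by simp [hx]) h').add ((tendsto_zetaSum hi hx h).const_mul _)

lemma index_ne_one_one {p q m : ℕ} {z : ℂ} (hqz : (q, z) ≠ (1, 1)) (hq : 1 ≤ q) (hm : m < p) :
    (p + q - m - 1, z) ≠ (1, 1) := by
  intro h
  obtain ⟨h1, rfl⟩ := Prod.mk.inj h
  exact hqz (by rw [show q = 1 by omega])

lemma tendsto_remainder {p q : ℕ} (hp : 1 ≤ p) (hq : 1 ≤ q) {x y : ℂ} (hx : ‖x‖ = 1)
    (hy : ‖y‖ = 1) (hpy : (p, y) ≠ (1, 1)) (hqxy : (q, x * y) ≠ (1, 1)) :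
    Tendsto (remainder p q x y) atTop (𝓝 (
      ∑ m ∈ Finset.range q, ((p + q - m - 2).choose (p - 1) : ℂ) * (-1) ^ (q - 1 - m) *
        ti (p + q - m - 1) y * (Li (m + 1) x⁻¹ + (-1) ^ (m + 1) * Li (m + 1) x)
      + (-1) ^ q * ∑ m ∈ Finset.range p, ((p + q - m - 2).choose (q - 1) : ℂ) *
        (x⁻¹ * (ti (p + q - m - 1) (x * y) * bilateralSum (m + 1) x) - ti (p + q) y))) := by
  have hx0 : x ≠ 0 := norm_ne_zero_iff.1 (by rw [hx]; norm_num)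
  have hz : ‖x * y‖ = 1 := by rw [norm_mul, hx, hy, one_mul]
  have hex : ∀ m : ℕ, ∃ S : ℕ → ℂ, m < p →
      (∀ M, Tendsto (fun J => ∑ j ∈ Finset.range J,
        (x * y) ^ (j + 1) / ((j : ℂ) + 1 / 2) ^ (p + q - m - 1) * window (m + 1) x M j) atTop
          (𝓝 (S M))) ∧
      Tendsto S atTop (𝓝 (ti (p + q - m - 1) (x * y) * bilateralSum (m + 1) x)) := by
    intro m
    by_cases hm : m < p
    · obtain ⟨S, hS⟩ := exists_tendsto_sum_window (i := m + 1) (r := p + q - m - 1) (by omega)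
        (by omega) hx hz (index_ne_one_one hqxy hq hm)
      exact ⟨S, fun _ => hS⟩
    · exact ⟨0, fun h => absurd h hm⟩
  choose S hS using hex
  have hti : ∀ r, 1 ≤ r → (r, y) ≠ (1, 1) →
      Tendsto (fun J => ∑ j ∈ Finset.range J, y ^ (j + 1) / ((j : ℂ) + 1 / 2) ^ r) atTop
        (𝓝 (ti r y)) := fun r hr h => by
    simpa only [tSum_eq_range] using tendsto_tSum hr hy h
  have heq : ∀ M, remainder p q x y M =
      ∑ m ∈ Finset.range q, ((p + q - m - 2).choose (p - 1) : ℂ) * (-1) ^ (q - 1 - m) *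
        ti (p + q - m - 1) y * (zetaSum M (m + 1) x⁻¹ + (-1) ^ (m + 1) * zetaSum M (m + 1) x)
      + (-1) ^ q * ∑ m ∈ Finset.range p, ((p + q - m - 2).choose (q - 1) : ℂ) *
        (x⁻¹ * S m M - ti (p + q) y) := by
    intro M
    refine tendsto_nhds_unique (tendsto_sum_doubleKernel hp q x hy hpy M) ?_
    have hlim : Tendsto (fun J =>
        ∑ m ∈ Finset.range q, ((p + q - m - 2).choose (p - 1) : ℂ) * (-1) ^ (q - 1 - m) *
          (∑ j ∈ Finset.range J, y ^ (j + 1) / ((j : ℂ) + 1 / 2) ^ (p + q - m - 1)) *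
            (zetaSum M (m + 1) x⁻¹ + (-1) ^ (m + 1) * zetaSum M (m + 1) x)
        + (-1) ^ q * ∑ m ∈ Finset.range p, ((p + q - m - 2).choose (q - 1) : ℂ) *
          (x⁻¹ * (∑ j ∈ Finset.range J,
            (x * y) ^ (j + 1) / ((j : ℂ) + 1 / 2) ^ (p + q - m - 1) * window (m + 1) x M j)
            - ∑ j ∈ Finset.range J, y ^ (j + 1) / ((j : ℂ) + 1 / 2) ^ (p + q))) atTop (𝓝 (
        ∑ m ∈ Finset.range q, ((p + q - m - 2).choose (p - 1) : ℂ) * (-1) ^ (q - 1 - m) *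
          ti (p + q - m - 1) y * (zetaSum M (m + 1) x⁻¹ + (-1) ^ (m + 1) * zetaSum M (m + 1) x)
        + (-1) ^ q * ∑ m ∈ Finset.range p, ((p + q - m - 2).choose (q - 1) : ℂ) *
          (x⁻¹ * S m M - ti (p + q) y))) := by
      refine Tendsto.add (tendsto_finsetSum _ fun m hm => ?_)
        (Tendsto.const_mul _ (tendsto_finsetSum _ fun m hm => ?_))
      · have hm := Finset.mem_range.1 hm
        have h := index_ne_one_one hpy hp hm
        rw [add_comm q p] at h
        exact ((hti _ (by omega) h).const_mul _).mul_const _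
      · have hm := Finset.mem_range.1 hm
        refine (Tendsto.sub (((hS m hm).1 M).const_mul _) (hti _ (by omega) fun h => ?_)).const_mul _
        have := (Prod.mk.inj h).1
        omega
    have hterm : ∀ j : ℕ, y ^ (j + 1) * doubleKernel p q x M j =
        ∑ m ∈ Finset.range q, ((p + q - m - 2).choose (p - 1) : ℂ) * (-1) ^ (q - 1 - m) *
          (y ^ (j + 1) / ((j : ℂ) + 1 / 2) ^ (p + q - m - 1)) *
            (zetaSum M (m + 1) x⁻¹ + (-1) ^ (m + 1) * zetaSum M (m + 1) x)
        + (-1) ^ q * ∑ m ∈ Finset.range p, ((p + q - m - 2).choose (q - 1) : ℂ) *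
          (x⁻¹ * ((x * y) ^ (j + 1) / ((j : ℂ) + 1 / 2) ^ (p + q - m - 1) * window (m + 1) x M j)
            - y ^ (j + 1) / ((j : ℂ) + 1 / 2) ^ (p + q)) := by
      intro j
      rw [doubleKernel_eq hp hq hx0, mul_add, mul_left_comm, Finset.mul_sum, Finset.mul_sum]
      congr 1
      · refine Finset.sum_congr rfl fun m _ => ?_
        ring
      · congr 1
        refine Finset.sum_congr rfl fun m hm => ?_
        have hm := Finset.mem_range.1 hm
        have h1 : (1 : ℂ) / ((j : ℂ) + 1 / 2) ^ (p + q) =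
            1 / ((j : ℂ) + 1 / 2) ^ (p + q - m - 1) * (1 / ((j : ℂ) + 1 / 2) ^ (m + 1)) := by
          rw [one_div_mul_one_div, ← pow_add]
          congr 2
          omega
        have h2 : x⁻¹ * (x * y) ^ (j + 1) = x ^ j * y ^ (j + 1) := by
          rw [mul_pow, pow_succ x]
          field_simp
        rw [div_eq_mul_one_div (y ^ (j + 1)), h1, div_eq_mul_one_div ((x * y) ^ (j + 1))]
        linear_combination -((p + q - m - 2).choose (q - 1) : ℂ) *
          (1 / ((j : ℂ) + 1 / 2) ^ (p + q - m - 1)) * window (m + 1) x M j * h2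
    refine hlim.congr fun J => ?_
    simp only [hterm]
    rw [Finset.sum_add_distrib, ← Finset.mul_sum (Finset.range J), Finset.sum_comm,
      Finset.sum_comm (s := Finset.range J) (t := Finset.range p)]
    congr 1
    · refine Finset.sum_congr rfl fun m _ => ?_
      rw [Finset.mul_sum, Finset.sum_mul]
    · congr 1
      refine Finset.sum_congr rfl fun m _ => ?_
      rw [← Finset.mul_sum, Finset.sum_sub_distrib, Finset.mul_sum (Finset.range J)]
  refine Tendsto.congr (fun M => (heq M).symm) ?_
  refine Tendsto.add (tendsto_finsetSum _ fun m hm => ?_)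
    (Tendsto.const_mul _ (tendsto_finsetSum _ fun m hm => ?_))
  · exact (tendsto_zetaSum_add (by omega) hx).const_mul _
  · exact ((((hS m (Finset.mem_range.1 hm)).2).const_mul _).sub_const _).const_mul _

lemma stPartial_sub_eq {y : ℂ} (hy : y ≠ 0) (x : ℂ) (p q M : ℕ) :
    y⁻¹ * stPartial M p q y (x * y)⁻¹ - (-1) ^ (p + q) * stPartial M p q y⁻¹ (x * y) =
      y⁻¹ * zetaSum M q (x * y)⁻¹ * ti p y + (-1) ^ q * y⁻¹ * zetaSum M q (x * y) * ti p y
        - y⁻¹ * remainder p q x y M := by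
  simp only [stPartial_eq_range, zetaSum_eq_range, remainder, Finset.mul_sum, Finset.sum_mul,
    ← Finset.sum_sub_distrib, ← Finset.sum_add_distrib]
  refine Finset.sum_congr rfl fun n _ => ?_
  push_cast
  rw [pow_add (-1 : ℂ)]
  linear_combination (-1) ^ q * (-1) ^ p * (x * y) ^ (n + 1) * (1 / ((n : ℂ) + 1) ^ q) *
    tSum (n + 1) p y⁻¹ * (inv_mul_cancel₀ hy)

end CyclotomicEuler

open CyclotomicEuler in
/-- Besides the identity, the conclusion records that all limits in it exist: the two `S̃`-sums
converge, and so do the series of `Li k z` and `ti k z` for every root of unity `z` and `k ≥ 1`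
with `(k, z) ≠ (1, 1)`. The only terms of the identity with `(k, z) = (1, 1)` are those for `x = 1`,
`m = 0`, where the bracket is a difference of two equal terms, `Li 1 1 - Li 1 1` or
`ti 1 1 - 1 * ti 1 1`, and is read as `0`. -/
theorem mainTheorem5 (x y : ℂ) (hx : IsRootOfUnity x) (hy : IsRootOfUnity y)
    (p q : ℕ) (hp : 1 ≤ p) (hq : 1 ≤ q)
    (hpy : (p, y) ≠ (1, 1)) (hqxy : (q, x * y) ≠ (1, 1)) :
    Converges (fun M : ℕ => stPartial M p q y (x * y)⁻¹) ∧
    Converges (fun M : ℕ => stPartial M p q y⁻¹ (x * y)) ∧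
    (∀ (k : ℕ) (z : ℂ), 1 ≤ k → IsRootOfUnity z → (k, z) ≠ (1, 1) →
      Converges (fun n : ℕ => zetaSum n k z) ∧ Converges (fun n : ℕ => tSum n k z)) ∧
    y⁻¹ * St p q y (x * y)⁻¹ - (-1) ^ (p + q) * St p q y⁻¹ (x * y) =
      y⁻¹ * Li q (x * y)⁻¹ * ti p y
      + (-1) ^ q * y⁻¹ * Li q (x * y) * ti p y
      + (-1) ^ q * ((p + q - 1).choose (p - 1) : ℂ) * y⁻¹ * ti (p + q) y
      + (-1) ^ q * (x * y)⁻¹ * ∑ m ∈ Finset.range p,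
          ((p + q - m - 2).choose (q - 1) : ℂ) * ti (p + q - m - 1) (x * y)
            * ((-1) ^ m * ti (m + 1) x - x * ti (m + 1) x⁻¹)
      + (-1) ^ q * y⁻¹ * ∑ m ∈ Finset.range q,
          ((p + q - m - 2).choose (p - 1) : ℂ) * ti (p + q - m - 1) y
            * ((-1) ^ m * Li (m + 1) x⁻¹ - Li (m + 1) x) := by
  have hx1 := hx.norm_eq_one
  have hy1 := hy.norm_eq_one
  have hy0 : y ≠ 0 := norm_ne_zero_iff.1 (by rw [hy1]; norm_num)
  have hz1 : ‖x * y‖ = 1 := by rw [norm_mul, hx1, hy1, one_mul]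
  have hz1' : ‖(x * y)⁻¹‖ = 1 := by rw [norm_inv, hz1, inv_one]
  have hy1' : ‖y⁻¹‖ = 1 := by rw [norm_inv, hy1, inv_one]
  have hpy' : (p, y⁻¹) ≠ (1, 1) := fun e => hpy (by simpa using e)
  have hqxy' : (q, (x * y)⁻¹) ≠ (1, 1) := fun e => hqxy (by
    rw [Prod.mk.injEq, inv_eq_one] at e
    rw [e.1, e.2])
  have hS := converges_stPartial hp hq hy1 hz1' hpy hqxy'
  have hS' := converges_stPartial hp hq hy1' hz1 hpy' hqxy
  refine ⟨hS, hS', fun k z hk hz hkz =>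
    ⟨converges_zetaSum hk hz.norm_eq_one hkz, converges_tSum hk hz.norm_eq_one hkz⟩, ?_⟩
  have hl := (hS.tendsto_limUnder.const_mul y⁻¹).sub
    (hS'.tendsto_limUnder.const_mul ((-1) ^ (p + q)))
  simp only [stPartial_sub_eq hy0] at hl
  have hr := (((tendsto_zetaSum hq hz1' hqxy').const_mul y⁻¹).mul_const (ti p y)).add
    (((tendsto_zetaSum hq hz1 hqxy).const_mul ((-1) ^ q * y⁻¹)).mul_const (ti p y)) |>.sub
    ((tendsto_remainder hp hq hx1 hy1 hpy hqxy).const_mul y⁻¹)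
  refine (tendsto_nhds_unique hl hr).trans ?_
  have h1 : ∑ m ∈ Finset.range q, ((p + q - m - 2).choose (p - 1) : ℂ) * (-1) ^ (q - 1 - m) *
      ti (p + q - m - 1) y * (Li (m + 1) x⁻¹ + (-1) ^ (m + 1) * Li (m + 1) x) =
      -(-1) ^ q * ∑ m ∈ Finset.range q, ((p + q - m - 2).choose (p - 1) : ℂ) *
        ti (p + q - m - 1) y * ((-1) ^ m * Li (m + 1) x⁻¹ - Li (m + 1) x) := by
    rw [Finset.mul_sum]
    refine Finset.sum_congr rfl fun m hm => ?_
    obtain ⟨k, rfl⟩ := Nat.exists_eq_add_of_lt (Finset.mem_range.1 hm)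
    have hs : (-1 : ℂ) ^ m * (-1) ^ m = 1 := by rw [← mul_pow]; simp
    rw [show m + k + 1 - 1 - m = k by omega, pow_succ (-1 : ℂ) (m + k), pow_add (-1 : ℂ) m k,
      pow_succ (-1 : ℂ) m]
    linear_combination -((p + (m + k + 1) - m - 2).choose (p - 1) : ℂ) * (-1) ^ k *
      ti (p + (m + k + 1) - m - 1) y * Li (m + 1) x⁻¹ * hs
  have h2 : ∑ m ∈ Finset.range p, ((p + q - m - 2).choose (q - 1) : ℂ) *
      (x⁻¹ * (ti (p + q - m - 1) (x * y) * bilateralSum (m + 1) x) - ti (p + q) y) =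
      -x⁻¹ * ∑ m ∈ Finset.range p, ((p + q - m - 2).choose (q - 1) : ℂ) *
        ti (p + q - m - 1) (x * y) * ((-1) ^ m * ti (m + 1) x - x * ti (m + 1) x⁻¹)
      - ((p + q - 1).choose (p - 1) : ℂ) * ti (p + q) y := by
    rw [← sum_choose_eq hp hq, Nat.cast_sum, Finset.sum_mul, Finset.mul_sum,
      ← Finset.sum_sub_distrib]
    refine Finset.sum_congr rfl fun m _ => ?_
    rw [bilateralSum, pow_succ]
    ring
  rw [h1, h2, mul_inv]
  ring
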